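/- Let $S=\mathbb{C}[x,y,z]$ and let $C: f=0$ be a reduced curve of degree $d\ge 3$ in the complex projective plane $\mathbb{P}^2$. Let $J_f=(f_x,f_y,f_z)\subset S$ be the Jacobian ideal, $M(f)=S/J_f$ the Milnor algebra, and $D_0(f)=\{(a,b,c)\in S^3 : af_x+bf_y+cf_z=0\}$ the graded module of Jacobian syzygies. Suppose that $C$ is a curve of type $(d,r,m)$, i.e. that $D_0(f)$ is minimally generated by $m$ homogeneous syzygies, all of the same degree $r$. Put $\Delta m=(2r-d+3)-m$. Then the following hold. (1) $M(f)$ has a minimal graded free resolution of the form $$0\to\bigoplus_{i=1}^{m-2}S(-e_i)\to S(1-d-r)^m\to S(1-d)^3\to S,$$ whose last map is $(a,b,c)\mapsto af_x+bf_y+cf_z$, and every minimal graded free resolution $0\to\bigoplus_{i=1}^{n} S(-e_i)\to\bigoplus_{j=1}^{k} S(-b_j)\to S(1-d)^3\to S$ of $M(f)$ with this last map has this form, i.e. $k=m$, $n=m-2$ and $b_j=d-1+r$ for all $j$. Moreover $e_j=d+r-1+\epsilon_j$ with integers $\epsilon_j\ge 1$, and $$\Delta m=\sum_{j=1}^{m-2}(\epsilon_j-1).$$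 (2) If $m=3$, then all the degrees in the resolution are determined by $(d,r)$: it is $$0\to S(-3r)\to S(1-d-r)^3\to S(1-d)^3\to S,$$ that is, $e_1=3r$. (3) If $m=3$, then the total Tjurina number $\tau(C)$, i.e. the degree of the Jacobian ideal $J_f$ (the constant value of $\dim_{\mathbb{C}} M(f)_k$ for all large $k$), is $$\tau(C)=3r(d-1-r).$$ -/

import Mathlib

namespace PlaneCurve

/-- The polynomial ring `S = ℂ[x, y, z]`. -/
abbrev S : Type := MvPolynomial (Fin 3) ℂ

/-- The Jacobian ideal `J_f`, generated by the partial derivatives of `f`. -/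
noncomputable def jacobianIdeal (f : S) : Ideal S :=
  Ideal.span (Set.range fun i : Fin 3 => MvPolynomial.pderiv i f)

/-- The Milnor (Jacobian) algebra `M(f) = S / J_f`. -/
abbrev MilnorAlgebra (f : S) : Type := S ⧸ jacobianIdeal f

/-- The component of degree `k` of `M(f)`: the classes of the forms of degree `k`. -/
noncomputable def milnorComponent (f : S) (k : ℕ) : Submodule ℂ (MilnorAlgebra f) :=
  (MvPolynomial.homogeneousSubmodule (Fin 3) ℂ k).map
    (Ideal.Quotient.mkₐ ℂ (jacobianIdeal f)).toLinearMap

/-- `τ` is the total Tjurina number of the curve `f = 0`, that is, the degree of its Jacobian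
ideal: the Hilbert polynomial of `M(f) = S / J_f` is the constant `τ`, in other words
`dim M(f)_k = τ` for all large `k`. At most one `τ` has this property. -/
def HasTotalTjurinaNumber (f : S) (τ : ℤ) : Prop :=
  ∀ᶠ k : ℕ in Filter.atTop, (Module.finrank ℂ (milnorComponent f k) : ℤ) = τ

/-- The map `S³ → S`, `(a, b, c) ↦ a f_x + b f_y + c f_z`. -/
noncomputable def jacobianMap (f : S) : (Fin 3 → S) →ₗ[S] S :=
  Fintype.linearCombination S (fun i : Fin 3 => MvPolynomial.pderiv i f)

/-- The module `D₀(f)` of Jacobian syzygies of `f`. -/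
noncomputable def jacobianSyzygies (f : S) : Submodule S (Fin 3 → S) :=
  LinearMap.ker (jacobianMap f)

/-- `D₀(f)` is minimally generated by `m` homogeneous syzygies of degrees `δ 0 ≤ δ 1 ≤ …`:
`f = 0` is an `m`-syzygy curve with exponents `δ`. -/
def HasExponents (f : S) {m : ℕ} (δ : Fin m → ℕ) : Prop :=
  Monotone δ ∧ ∃ ρ : Fin m → (Fin 3 → S),
    (∀ j i, (ρ j i).IsHomogeneous (δ j)) ∧
    Submodule.span S (Set.range ρ) = jacobianSyzygies f ∧
    ∀ j, ρ j ∉ Submodule.span S (ρ '' {i | i ≠ j})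

/-- `f = 0` is a curve of type `(d, r, m)`: a reduced plane curve of degree `d ≥ 3` whose module
of Jacobian syzygies is minimally generated by `m` homogeneous syzygies, all of degree `r`. -/
structure IsCurveOfType (f : S) (d r m : ℕ) : Prop where
  three_le : 3 ≤ d
  homogeneous : f.IsHomogeneous d
  reduced : Squarefree f
  exponents : HasExponents f (fun _ : Fin m => r)

/-- `p` is homogeneous of degree `k`, with `k` an integer (so `p = 0` if `k < 0`). -/
def IsHomogeneousZ (p : S) (k : ℤ) : Prop :=
  ∀ s ∈ p.support, ((Finsupp.degree s : ℕ) : ℤ) = k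

theorem isHomogeneousZ_natCast (p : S) (k : ℕ) :
    IsHomogeneousZ p (k : ℤ) ↔ p.IsHomogeneous k := by
  simp only [IsHomogeneousZ, MvPolynomial.IsHomogeneous, MvPolynomial.IsWeightedHomogeneous,
    MvPolynomial.mem_support_iff, Finsupp.degree_eq_weight_one, Nat.cast_inj]
  exact ⟨fun h s hs => h s hs, fun h s hs => h hs⟩

/-- A homomorphism `⨁ⱼ S(-b j) → ⨁ᵢ S(-a i)` of graded modules (homogeneous of degree `0`): it
sends the `j`-th basis vector, which has degree `b j`, to an element of degree `b j`, whose
`i`-th coordinate is therefore a form of degree `b j - a i`. -/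
def IsGradedHom {p q : ℕ} (b : Fin p → ℤ) (a : Fin q → ℤ)
    (φ : (Fin p → S) →ₗ[S] (Fin q → S)) : Prop :=
  ∀ j i, IsHomogeneousZ (φ (Pi.single j 1) i) (b j - a i)

/-- The entries of the matrix of `φ` lie in the ideal `(x, y, z)`. -/
def IsMinimalHom {p q : ℕ} (φ : (Fin p → S) →ₗ[S] (Fin q → S)) : Prop :=
  ∀ j i, MvPolynomial.constantCoeff (φ (Pi.single j 1) i) = 0

/-- The Milnor algebra `M(f)` of a form `f` of degree `d` has a minimal graded free resolution
`0 → ⨁_{i < n} S(-e i) → ⨁_{j < k} S(-b j) → S(1-d)³ → S`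
whose last map is `(a, b, c) ↦ a f_x + b f_y + c f_z`, with cokernel `M(f)`. The entries of this
last map are forms of degree `d - 1`, so for `d ≥ 2` minimality only concerns the other two. The
order of the degrees `b j` and `e i` is left free. -/
def HasMinimalResolution (f : S) (d : ℕ) {k n : ℕ} (b : Fin k → ℤ) (e : Fin n → ℤ) : Prop :=
  ∃ (φ : (Fin k → S) →ₗ[S] (Fin 3 → S)) (ψ : (Fin n → S) →ₗ[S] (Fin k → S)),
    IsGradedHom b (fun _ => (d : ℤ) - 1) φ ∧ IsGradedHom e b ψ ∧
    IsMinimalHom φ ∧ IsMinimalHom ψ ∧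
    LinearMap.range φ = LinearMap.ker (jacobianMap f) ∧
    LinearMap.range ψ = LinearMap.ker φ ∧
    Function.Injective ψ

/-- `m(d, r)_max = 2r - d + 3`. -/
def mMax (d r : ℕ) : ℤ := 2 * (r : ℤ) - (d : ℤ) + 3

/-- The defect `Δm = m(d, r)_max - m`. -/
def defect (d r m : ℕ) : ℤ := mMax d r - (m : ℤ)

end PlaneCurve

/-!
Let `J_f` be the Jacobian ideal and let `φ : ⨁ⱼ S(1-d-r) → S(1-d)³` be given by the minimal
generators of `D₀(f)`. The kernel of `φ` is a second syzygy module over `S = ℂ[x, y, z]`, so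
`x, y, z` is a regular sequence on it, and hence it is free; this gives the resolution. The degrees
in a minimal resolution are unique because the transition matrices between two minimal systems of
generators become mutually inverse modulo `(x, y, z)`.

Since `f` is reduced, no irreducible form divides all its partial derivatives, so `J_f` contains two
coprime forms of degree `d - 1`. Their Koszul relation bounds the Hilbert function of `M(f)` by
`(d - 1) ^ 2`, so the Hilbert polynomial read off from a resolution is constant. The vanishing of
its quadratic and linear coefficients gives the number of second syzygies and the sum of their
degrees, and for `m = 3` its constant term is `τ(C)`.
-/

namespace PlaneCurve

open MvPolynomial

/-! ### Forms and graded free modules -/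

section Forms

variable {σ R ι : Type*} [CommSemiring R]

variable (σ R) in
/-- The space of forms of degree `k`, where `k` is an integer: it is `0` if `k < 0`. -/
noncomputable def forms (k : ℤ) : Submodule R (MvPolynomial σ R) :=
  weightedHomogeneousSubmodule R (fun _ : σ => (1 : ℤ)) k

theorem mem_forms {p : MvPolynomial σ R} {k : ℤ} :
    p ∈ forms σ R k ↔ ∀ s ∈ p.support, ((Finsupp.degree s : ℕ) : ℤ) = k := by
  simp only [forms, mem_weightedHomogeneousSubmodule, IsWeightedHomogeneous, mem_support_iff,
    Finsupp.weight_apply, Finsupp.degree_apply, Finsupp.sum, nsmul_eq_mul, mul_one, Nat.cast_sum]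

theorem mem_forms_natCast {p : MvPolynomial σ R} {k : ℕ} :
    p ∈ forms σ R k ↔ p.IsHomogeneous k := by
  simp only [mem_forms, IsHomogeneous, IsWeightedHomogeneous, mem_support_iff,
    Finsupp.degree_eq_weight_one, Nat.cast_inj, Pi.one_def, ne_eq]

theorem forms_natCast (k : ℕ) : forms σ R k = homogeneousSubmodule σ R k :=
  Submodule.ext fun _ => mem_forms_natCast

theorem forms_eq_bot {k : ℤ} (hk : k < 0) : forms σ R k = ⊥ := by
  refine eq_bot_iff.2 fun p hp => ?_
  by_contra hne
  obtain ⟨s, hs⟩ := exists_coeff_ne_zero hne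
  have := mem_forms.1 hp s (mem_support_iff.2 hs)
  lia

theorem constantCoeff_eq_zero_of_mem_forms {p : MvPolynomial σ R} {k : ℤ}
    (hp : p ∈ forms σ R k) (hk : k ≠ 0) : constantCoeff p = 0 :=
  IsWeightedHomogeneous.coeff_eq_zero hp 0 (by simpa using hk.symm)

/-- The component of degree `k` of a polynomial, where `k` is an integer. -/
noncomputable def component (k : ℤ) : MvPolynomial σ R →ₗ[R] MvPolynomial σ R :=
  weightedHomogeneousComponent (fun _ : σ => (1 : ℤ)) k

theorem component_mem_forms (k : ℤ) (p : MvPolynomial σ R) : component k p ∈ forms σ R k :=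
  weightedHomogeneousComponent_mem _ _ _

theorem component_eq_self {k : ℤ} {p : MvPolynomial σ R} (hp : p ∈ forms σ R k) :
    component k p = p :=
  IsWeightedHomogeneous.weightedHomogeneousComponent_same hp

theorem component_mul_of_mem_forms {q : MvPolynomial σ R} {l : ℤ} (hq : q ∈ forms σ R l) (k : ℤ)
    (p : MvPolynomial σ R) : component k (p * q) = component (k - l) p * q := by
  let : GradedAlgebra (forms σ R) := weightedGradedAlgebra R _
  have hcomponent (k : ℤ) (p : MvPolynomial σ R) :
      (DirectSum.decompose (forms σ R) p k : MvPolynomial σ R) = component k p :=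
    weightedDecomposition.decompose'_apply R _ p k
  rw [← hcomponent, ← hcomponent, ← DirectSum.coe_decompose_mul_add_of_right_mem _ hq,
    sub_add_cancel]

theorem component_zero (p : MvPolynomial σ R) : component 0 p = C (constantCoeff p) := by
  classical
  ext s
  have hs : Finsupp.weight (fun _ : σ => (1 : ℤ)) s = 0 ↔ 0 = s := by
    rw [eq_comm (a := 0), ← Finsupp.degree_eq_zero_iff, ← Nat.cast_eq_zero (R := ℤ)]
    simp [Finsupp.weight_apply, Finsupp.degree_apply, Finsupp.sum]
  simp only [component, coeff_weightedHomogeneousComponent, coeff_C, hs]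
  split_ifs with h
  · rw [← h, constantCoeff_eq]
  · rfl

variable (σ R) in
/-- The piece of degree `k` of the graded module `⨁ⱼ S(-b j)`, where `S` is the polynomial ring. -/
noncomputable def gradedPiece (b : ι → ℤ) (k : ℤ) : Submodule R (ι → MvPolynomial σ R) :=
  Submodule.pi Set.univ fun j => forms σ R (k - b j)

theorem mem_gradedPiece {b : ι → ℤ} {k : ℤ} {v : ι → MvPolynomial σ R} :
    v ∈ gradedPiece σ R b k ↔ ∀ j, v j ∈ forms σ R (k - b j) := by
  simp [gradedPiece]

/-- The component of degree `k` of an element of the graded module `⨁ⱼ S(-b j)`. -/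
noncomputable def gradedComponent (b : ι → ℤ) (k : ℤ) :
    (ι → MvPolynomial σ R) →ₗ[R] (ι → MvPolynomial σ R) :=
  LinearMap.pi fun j => component (k - b j) ∘ₗ LinearMap.proj j

theorem gradedComponent_apply (b : ι → ℤ) (k : ℤ) (v : ι → MvPolynomial σ R) (j : ι) :
    gradedComponent b k v j = component (k - b j) (v j) := rfl

theorem gradedComponent_mem_gradedPiece (b : ι → ℤ) (k : ℤ) (v : ι → MvPolynomial σ R) :
    gradedComponent b k v ∈ gradedPiece σ R b k :=
  mem_gradedPiece.2 fun _ => component_mem_forms _ _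

theorem gradedComponent_eq_self {b : ι → ℤ} {k : ℤ} {v : ι → MvPolynomial σ R}
    (hv : v ∈ gradedPiece σ R b k) : gradedComponent b k v = v :=
  funext fun j => component_eq_self (mem_gradedPiece.1 hv j)

theorem gradedComponent_smul {b : ι → ℤ} {l : ℤ} {v : ι → MvPolynomial σ R}
    (hv : v ∈ gradedPiece σ R b l) (k : ℤ) (c : MvPolynomial σ R) :
    gradedComponent b k (c • v) = component (k - l) c • v := by
  funext j
  simp only [gradedComponent_apply, Pi.smul_apply, smul_eq_mul,
    component_mul_of_mem_forms (mem_gradedPiece.1 hv j), sub_sub_sub_cancel_right]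

theorem gradedComponent_sum_smul {κ : Type*} [Fintype κ] {b : ι → ℤ} {δ : κ → ℤ}
    {ρ : κ → ι → MvPolynomial σ R} (hρ : ∀ i, ρ i ∈ gradedPiece σ R b (δ i)) (k : ℤ)
    (c : κ → MvPolynomial σ R) :
    gradedComponent b k (∑ i, c i • ρ i) = ∑ i, component (k - δ i) (c i) • ρ i := by
  simp only [map_sum, gradedComponent_smul (hρ _)]

theorem finite_support_gradedComponent [Finite ι] (b : ι → ℤ) (v : ι → MvPolynomial σ R) :
    (fun k => gradedComponent b k v).HasFiniteSupport := by
  refine (Set.finite_iUnion fun j => (weightedHomogeneousComponent_finsupp (w := fun _ => (1 : ℤ))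
    (v j)).preimage (sub_left_injective (b := b j)).injOn).subset fun k hk => ?_
  obtain ⟨j, hj⟩ := Function.ne_iff.1 hk
  exact Set.mem_iUnion.2 ⟨j, hj⟩

theorem finsum_gradedComponent [Finite ι] (b : ι → ℤ) (v : ι → MvPolynomial σ R) :
    ∑ᶠ k, gradedComponent b k v = v := by
  funext j
  calc (∑ᶠ k, gradedComponent b k v) j = ∑ᶠ k, component (k - b j) (v j) :=
        finsum_apply (finite_support_gradedComponent b v) j
    _ = ∑ᶠ k, component k (v j) :=
        finsum_comp_equiv (Equiv.subRight (b j)) (f := fun k => component k (v j))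
    _ = v j := finsum_weightedHomogeneousComponent _ (v j)

end Forms

/-! ### Minimal systems of generators -/

section Relations

variable {A M ι κ : Type*} [CommRing A] [AddCommGroup M] [Module A M] [Fintype ι] [Fintype κ]

/-- All linear relations between the `ρ i` have their coefficients in the ideal `I`. This is linear
independence if `I = ⊥`; for homogeneous `ρ i` over a polynomial ring over a field, with `I` the
ideal of the variables, it says that the `ρ i` are a minimal system of generators of their span. -/
def RelationsIn (I : Ideal A) (ρ : ι → M) : Prop :=
  ∀ c : ι → A, ∑ i, c i • ρ i = 0 → ∀ i, c i ∈ I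

theorem relationsIn_bot {ρ : ι → M} : RelationsIn (⊥ : Ideal A) ρ ↔ LinearIndependent A ρ := by
  simp only [RelationsIn, Fintype.linearIndependent_iff, Submodule.mem_bot]

theorem RelationsIn.mem_of_sum_smul_mem {I : Ideal A} {ρ : ι → M} (hρ : RelationsIn I ρ)
    {c : ι → A} (hc : ∑ i, c i • ρ i ∈ I • Submodule.span A (Set.range ρ)) (i : ι) : c i ∈ I := by
  obtain ⟨a, ha, hac⟩ := (Submodule.mem_ideal_smul_span_iff_exists_sum I ρ _).1 hc
  rw [Finsupp.sum_fintype _ _ (by simp)] at hac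
  have hrel : ∑ i, (c i - a i) • ρ i = 0 := by
    simp only [sub_smul, Finset.sum_sub_distrib, hac, sub_self]
  exact (Submodule.sub_mem_iff_left I (ha i)).1 (hρ _ hrel i)

theorem RelationsIn.map_mul_map_eq_one [DecidableEq ι] {B : Type*} [CommRing B] {g : A →+* B}
    {ρ : ι → M} (hρ : RelationsIn (RingHom.ker g) ρ) {ρ' : κ → M} {V : Matrix ι κ A}
    {W : Matrix κ ι A} (hV : ∀ i, ρ i = ∑ j, V i j • ρ' j) (hW : ∀ j, ρ' j = ∑ i, W j i • ρ i) :
    V.map g * W.map g = 1 := by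
  ext i l
  have hrel : ∑ l, ((V * W) i l - (1 : Matrix ι ι A) i l) • ρ l = 0 := by
    calc ∑ l, ((V * W) i l - (1 : Matrix ι ι A) i l) • ρ l
        = ∑ j, V i j • ∑ l, W j l • ρ l - ρ i := by
          simp only [Matrix.mul_apply, Matrix.one_apply, sub_smul, Finset.sum_sub_distrib,
            Finset.sum_smul, Finset.smul_sum, mul_smul, ite_smul, one_smul, zero_smul,
            Finset.sum_ite_eq, Finset.mem_univ, if_true]
          rw [Finset.sum_comm]
      _ = 0 := by simp only [← hW, ← hV, sub_self]
  have h := hρ _ hrel l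
  rw [RingHom.mem_ker, map_sub, sub_eq_zero] at h
  rw [← Matrix.map_mul, Matrix.map_apply, h, Matrix.one_apply, Matrix.one_apply]
  split_ifs <;> simp only [map_one, map_zero]

end Relations

theorem exists_equiv_forall_ne_zero_of_mul_eq_one {ι κ B : Type*} [Fintype ι] [Fintype κ]
    [DecidableEq ι] [DecidableEq κ] [CommRing B] [Nontrivial B] {V : Matrix ι κ B}
    {W : Matrix κ ι B} (hVW : V * W = 1) (hWV : W * V = 1) :
    ∃ π : κ ≃ ι, ∀ j, V (π j) j ≠ 0 := by
  obtain ⟨π₀⟩ := Fintype.card_eq.1 (Matrix.square_of_invertible V W hVW hWV)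
  have hdet : (V.submatrix id π₀).det ≠ 0 := by
    have hmul : V.submatrix id π₀ * W.submatrix π₀ id = 1 := by
      rw [Matrix.submatrix_mul_equiv, hVW, Matrix.submatrix_id_id]
    exact (Matrix.isUnit_det_of_right_inverse hmul).ne_zero
  rw [Matrix.det_apply] at hdet
  obtain ⟨τ, -, hτ⟩ := Finset.exists_ne_zero_of_sum_ne_zero hdet
  refine ⟨π₀.symm.trans τ, fun j hj => hτ ?_⟩
  rw [Finset.prod_eq_zero (Finset.mem_univ (π₀.symm j)), smul_zero]
  simpa using hj

section Generators

variable {σ ι κ : Type*} {K : Type*} [Field K] [Fintype κ]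

theorem mem_idealOfVars {R : Type*} [CommRing R] {p : MvPolynomial σ R} :
    p ∈ idealOfVars σ R ↔ constantCoeff p = 0 := by
  rw [← pow_one (idealOfVars σ R), mem_pow_idealOfVars_iff']
  simp only [Nat.lt_one_iff, Finsupp.degree_eq_zero_iff, forall_eq, constantCoeff_eq]

theorem idealOfVars_eq_ker {R : Type*} [CommRing R] :
    idealOfVars σ R = RingHom.ker (constantCoeff : MvPolynomial σ R →+* R) :=
  Ideal.ext fun _ => mem_idealOfVars

theorem relationsIn_idealOfVars_of_irredundant {a : ι → ℤ} {δ : κ → ℤ}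
    {ρ : κ → ι → MvPolynomial σ K} (hρ : ∀ i, ρ i ∈ gradedPiece σ K a (δ i))
    (hmin : ∀ j, ρ j ∉ Submodule.span (MvPolynomial σ K) (ρ '' {i | i ≠ j})) :
    RelationsIn (idealOfVars σ K) ρ := by
  classical
  intro c hc j
  rw [mem_idealOfVars]
  by_contra hj
  refine hmin j ?_
  have hdegree : (C (constantCoeff (c j)) : MvPolynomial σ K) • ρ j +
      ∑ i ∈ Finset.univ.erase j, component (δ j - δ i) (c i) • ρ i = 0 := by
    rw [← component_zero, ← sub_self (δ j), Finset.add_sum_erase _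
      (fun i => component (δ j - δ i) (c i) • ρ i) (Finset.mem_univ j),
      ← gradedComponent_sum_smul hρ, hc, map_zero]
  have hunit : IsUnit (C (constantCoeff (c j)) : MvPolynomial σ K) :=
    (isUnit_iff_ne_zero.2 hj).map C
  rw [← Submodule.smul_mem_iff_of_isUnit _ hunit, eq_neg_of_add_eq_zero_left hdegree]
  refine Submodule.neg_mem _ (Submodule.sum_mem _ fun i hi => Submodule.smul_mem _ _ ?_)
  exact Submodule.subset_span ⟨i, Finset.ne_of_mem_erase hi, rfl⟩

theorem exists_mem_forms_eq_sum_smul {R : Type*} [CommRing R] {a : ι → ℤ} {δ : κ → ℤ}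
    {ρ : κ → ι → MvPolynomial σ R} (hρ : ∀ i, ρ i ∈ gradedPiece σ R a (δ i)) {k : ℤ}
    {v : ι → MvPolynomial σ R} (hv : v ∈ gradedPiece σ R a k)
    (hspan : v ∈ Submodule.span (MvPolynomial σ R) (Set.range ρ)) :
    ∃ c : κ → MvPolynomial σ R, (∀ i, c i ∈ forms σ R (k - δ i)) ∧ v = ∑ i, c i • ρ i := by
  obtain ⟨c, hc⟩ := (Submodule.mem_span_range_iff_exists_fun _).1 hspan
  refine ⟨fun i => component (k - δ i) (c i), fun i => component_mem_forms _ _, ?_⟩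
  rw [← gradedComponent_sum_smul hρ, hc, gradedComponent_eq_self hv]

theorem exists_equiv_degree_eq [Fintype ι] {τ : Type*} {a : τ → ℤ} {δ : ι → ℤ} {b : κ → ℤ}
    {ρ : ι → τ → MvPolynomial σ K} {ρ' : κ → τ → MvPolynomial σ K}
    (hρ : ∀ i, ρ i ∈ gradedPiece σ K a (δ i)) (hρ' : ∀ j, ρ' j ∈ gradedPiece σ K a (b j))
    (hmin : RelationsIn (idealOfVars σ K) ρ) (hmin' : RelationsIn (idealOfVars σ K) ρ')
    (hspan : Submodule.span (MvPolynomial σ K) (Set.range ρ) =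
      Submodule.span (MvPolynomial σ K) (Set.range ρ')) :
    ∃ π : κ ≃ ι, ∀ j, δ (π j) = b j := by
  classical
  choose V hVforms hV using fun i => exists_mem_forms_eq_sum_smul hρ' (hρ i)
    (hspan ▸ Submodule.subset_span ⟨i, rfl⟩)
  choose W hWforms hW using fun j => exists_mem_forms_eq_sum_smul hρ (hρ' j)
    (hspan ▸ Submodule.subset_span ⟨j, rfl⟩)
  rw [idealOfVars_eq_ker] at hmin hmin'
  obtain ⟨π, hπ⟩ := exists_equiv_forall_ne_zero_of_mul_eq_one
    (hmin.map_mul_map_eq_one hV hW) (hmin'.map_mul_map_eq_one hW hV)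
  refine ⟨π, fun j => ?_⟩
  by_contra hne
  exact hπ j (constantCoeff_eq_zero_of_mem_forms (hVforms (π j) j) (sub_ne_zero.2 hne))

end Generators

theorem exists_finset_irredundant {A M : Type*} [CommRing A] [AddCommGroup M] [Module A M]
    [IsNoetherian A M] (H : Set M) :
    ∃ T : Finset M, ↑T ⊆ H ∧ Submodule.span A (T : Set M) = Submodule.span A H ∧
      ∀ v ∈ T, v ∉ Submodule.span A (T \ {v} : Set M) := by
  classical
  obtain ⟨T₀, hT₀, hspan₀⟩ := Submodule.fg_span_iff_fg_span_finset_subset H |>.1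
    (IsNoetherian.noetherian (Submodule.span A H))
  obtain ⟨T, -, ⟨hTH, hT⟩, hmin⟩ := exists_minimal_le_of_wellFoundedLT
    (fun T : Finset M => ↑T ⊆ H ∧ Submodule.span A (T : Set M) = Submodule.span A H) T₀
    ⟨hT₀, hspan₀.symm⟩
  refine ⟨T, hTH, hT, fun v hv hmem => ?_⟩
  have herase : Submodule.span A (T.erase v : Set M) = Submodule.span A H := by
    rw [Finset.coe_erase, ← hT, ← Submodule.span_insert_eq_span hmem, Set.insert_sdiff_singleton,
      Set.insert_eq_of_mem (Finset.mem_coe.2 hv)]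
  have hle := hmin ⟨(Finset.coe_subset.2 (T.erase_subset v)).trans hTH, herase⟩ (T.erase_subset v)
  exact Finset.notMem_erase v T (hle hv)

theorem exists_minimal_homogeneous_generators {σ ι K : Type*} [Finite σ] [Finite ι] [Field K]
    {a : ι → ℤ} {N : Submodule (MvPolynomial σ K) (ι → MvPolynomial σ K)}
    (hN : ∀ k, ∀ v ∈ N, gradedComponent a k v ∈ N) :
    ∃ (t : ℕ) (e : Fin t → ℤ) (ν : Fin t → ι → MvPolynomial σ K),
      (∀ i, ν i ∈ gradedPiece σ K a (e i)) ∧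
      Submodule.span (MvPolynomial σ K) (Set.range ν) = N ∧
      RelationsIn (idealOfVars σ K) ν := by
  let H := {v | v ∈ N ∧ ∃ k, v ∈ gradedPiece σ K a k}
  have hH : Submodule.span (MvPolynomial σ K) H = N := by
    refine le_antisymm (Submodule.span_le.2 fun v hv => hv.1) fun v hv => ?_
    rw [← finsum_gradedComponent a v]
    exact finsum_induction (· ∈ Submodule.span _ H) (zero_mem _) (fun _ _ => add_mem) fun k =>
      Submodule.subset_span ⟨hN k v hv, k, gradedComponent_mem_gradedPiece _ _ _⟩
  obtain ⟨T, hTH, hT, hirr⟩ := exists_finset_irredundant (A := MvPolynomial σ K) H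
  choose e he using fun v : T => (hTH v.2).2
  let E := T.equivFin.symm
  refine ⟨T.card, fun i => e (E i), fun i => E i, fun i => he (E i), ?_,
    relationsIn_idealOfVars_of_irredundant (fun i => he (E i)) fun j hj => ?_⟩
  · have hrange : Set.range (fun i => (E i : ι → MvPolynomial σ K)) = T :=
      (EquivLike.range_comp Subtype.val E).trans Subtype.range_coe
    rw [hrange, hT, hH]
  · refine hirr (E j) (E j).2 (Submodule.span_mono ?_ hj)
    rintro _ ⟨i, hij, rfl⟩
    exact ⟨(E i).2, fun h => hij (E.injective (Subtype.ext h))⟩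

/-! ### Depth and freeness -/

section Depth

open RingTheory.Sequence

variable {A F N : Type*} [CommRing A] [AddCommGroup F] [Module A F] [AddCommGroup N] [Module A N]

theorem isSMulRegular_ker_quotient {f : F →ₗ[A] N} {rs : List A} {r : A}
    (hr : IsSMulRegular (F ⧸ (Ideal.ofList rs • ⊤ : Submodule A F)) r)
    (hrange : IsWeaklyRegular (LinearMap.range f) rs) :
    IsSMulRegular (LinearMap.ker f ⧸ (Ideal.ofList rs • ⊤ : Submodule A (LinearMap.ker f))) r := by
  have hexact := map_first_exact_on_four_term_right_exact_of_isSMulRegular_last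
    (f₁ := (0 : LinearMap.ker f →ₗ[A] LinearMap.ker f)) (f₂ := (LinearMap.ker f).subtype)
    (f₃ := f.rangeRestrict)
    ((LinearMap.exact_zero_iff_injective _ _).2 (Submodule.subtype_injective _))
    (LinearMap.exact_iff.2 (by simp)) f.surjective_rangeRestrict hrange
  rw [Submodule.mapQ_zero] at hexact
  exact hr.of_injective _ ((LinearMap.exact_zero_iff_injective _ _).1 hexact)

theorem isWeaklyRegular_ker_append_singleton {f : F →ₗ[A] N} {rs : List A} {r : A}
    (hF : IsWeaklyRegular F (rs ++ [r])) (hrange : IsWeaklyRegular (LinearMap.range f) rs) :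
    IsWeaklyRegular (LinearMap.ker f) (rs ++ [r]) := by
  induction rs using List.reverseRecOn generalizing r with
  | nil =>
    rw [isWeaklyRegular_append_iff, isWeaklyRegular_singleton_iff] at hF ⊢
    exact ⟨.nil A _, isSMulRegular_ker_quotient hF.2 hrange⟩
  | append_singleton rs r' ih =>
    rw [isWeaklyRegular_append_iff, isWeaklyRegular_singleton_iff] at hF ⊢
    exact ⟨ih hF.1 ((isWeaklyRegular_append_iff _ _ _).1 hrange).1,
      isSMulRegular_ker_quotient hF.2 hrange⟩

end Depth

theorem mem_ideal_smul_top_pi {A ι : Type*} [CommRing A] [Finite ι] {I : Ideal A} {v : ι → A} :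
    v ∈ (I • ⊤ : Submodule A (ι → A)) ↔ ∀ i, v i ∈ I := by
  have := Fintype.ofFinite ι
  have hsum : ∑ i, v i • Pi.basisFun A ι i = v := (Pi.basisFun A ι).sum_repr v
  refine ⟨fun hv => ?_, fun hv => hsum ▸ sum_mem fun i _ => Submodule.smul_mem_smul (hv i) trivial⟩
  have hrel : RelationsIn I (Pi.basisFun A ι) := fun c hc i => by
    rw [Fintype.linearIndependent_iff.1 (Pi.basisFun A ι).linearIndependent c hc i]
    exact I.zero_mem
  rw [← hsum, ← (Pi.basisFun A ι).span_eq] at hv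
  exact hrel.mem_of_sum_smul_mem hv

theorem RelationsIn.of_sup_span_singleton {A N ι : Type*} [CommRing A] [AddCommGroup N]
    [Module A N] [Fintype ι] {n : ι → N} {I : Ideal A} {x : A}
    (hspan : Submodule.span A (Set.range n) = ⊤)
    (hreg : IsSMulRegular (N ⧸ (I • ⊤ : Submodule A N)) x)
    (hI : ∀ a, (∀ k : ℕ, a ∈ I ⊔ Ideal.span {x ^ k}) → a ∈ I)
    (hrel : RelationsIn (I ⊔ Ideal.span {x}) n) : RelationsIn I n := by
  suffices h : ∀ (k : ℕ) (c : ι → A), ∑ i, c i • n i ∈ (I • ⊤ : Submodule A N) →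
      ∀ i, c i ∈ I ⊔ Ideal.span {x ^ k} from
    fun c hc i => hI _ fun k => h k c (hc ▸ zero_mem _) i
  intro k
  induction k with
  | zero => simp
  | succ k ih =>
    intro c hc
    have hmem := hrel.mem_of_sum_smul_mem
      (hspan.symm ▸ Submodule.smul_mono_left (le_sup_left (b := Ideal.span {x})) hc)
    choose d hd w hw hdw using fun i => Submodule.mem_sup.1 (hmem i)
    choose c' hc' using fun i => Ideal.mem_span_singleton'.1 (hw i)
    have hquot : ∑ i, c' i • n i ∈ (I • ⊤ : Submodule A N) := by
      refine mem_of_isSMulRegular_quotient_of_smul_mem hreg ?_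
      have hsub : x • ∑ i, c' i • n i = ∑ i, c i • n i - ∑ i, d i • n i := by
        simp only [Finset.smul_sum, ← Finset.sum_sub_distrib, ← sub_smul, smul_smul, ← hdw, ← hc',
          add_sub_cancel_left, mul_comm x]
      rw [hsub]
      exact sub_mem hc (sum_mem fun i _ => Submodule.smul_mem_smul (hd i) trivial)
    intro i
    obtain ⟨u, hu, v, hv, huv⟩ := Submodule.mem_sup.1 (ih c' hquot i)
    obtain ⟨v, rfl⟩ := Ideal.mem_span_singleton'.1 hv
    rw [← hdw, ← hc', ← huv]
    exact Submodule.mem_sup.2 ⟨d i + u * x, I.add_mem (hd i) (I.mul_mem_right _ hu),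
      v * x ^ (k + 1), Ideal.mem_span_singleton'.2 ⟨v, rfl⟩, by ring⟩

section Variables

open RingTheory.Sequence

variable {σ R : Type*} [CommRing R]

theorem mem_of_X_mul_mem {s : Set σ} {i : σ} (hi : i ∉ s) {p : MvPolynomial σ R}
    (h : X i * p ∈ Ideal.span (X '' s : Set (MvPolynomial σ R))) :
    p ∈ Ideal.span (X '' s : Set (MvPolynomial σ R)) := by
  classical
  rw [mem_ideal_span_X_image] at h ⊢
  intro m hm
  obtain ⟨j, hj, hmj⟩ := h (Finsupp.single i 1 + m)
    (by rwa [mem_support_iff, coeff_X_mul, ← mem_support_iff])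
  have hij : i ≠ j := fun h => hi (h ▸ hj)
  exact ⟨j, hj, by simpa [Finsupp.single_apply, hij] using hmj⟩

theorem mem_of_forall_mem_sup_X_pow {s : Set σ} {i : σ} {p : MvPolynomial σ R}
    (h : ∀ k : ℕ, p ∈ Ideal.span (X '' s : Set (MvPolynomial σ R)) ⊔ Ideal.span {X i ^ k}) :
    p ∈ Ideal.span (X '' s : Set (MvPolynomial σ R)) := by
  classical
  rw [mem_ideal_span_X_image]
  intro m hm
  obtain ⟨u, hu, w, hw, rfl⟩ := Submodule.mem_sup.1 (h (m i + 1))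
  obtain ⟨w, rfl⟩ := Ideal.mem_span_singleton'.1 hw
  have hlt : ¬ Finsupp.single i (m i + 1) ≤ m := fun hle => by simpa using hle i
  rw [mem_support_iff, coeff_add, X_pow_eq_monomial, coeff_mul_monomial', if_neg hlt, add_zero,
    ← mem_support_iff] at hm
  exact (mem_ideal_span_X_image.1 hu) m hm

theorem ofList_map_X (l : List σ) :
    Ideal.ofList (l.map (X : σ → MvPolynomial σ R)) = Ideal.span (X '' {i | i ∈ l}) := by
  rw [Ideal.ofList]
  congr 1
  ext p
  simp

theorem isWeaklyRegular_pi_map_X {ι : Type*} [Finite ι] {l : List σ} (hl : l.Nodup) :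
    IsWeaklyRegular (ι → MvPolynomial σ R) (l.map (X : σ → MvPolynomial σ R)) := by
  induction l using List.reverseRecOn with
  | nil => exact .nil _ _
  | append_singleton l i ih =>
    rw [List.nodup_append_comm, List.singleton_append, List.nodup_cons] at hl
    rw [List.map_append, isWeaklyRegular_append_iff, List.map_singleton,
      isWeaklyRegular_singleton_iff, isSMulRegular_quotient_iff_mem_of_smul_mem, ofList_map_X]
    refine ⟨ih hl.2, fun v hv => ?_⟩
    rw [mem_ideal_smul_top_pi] at hv ⊢
    exact fun j => mem_of_X_mul_mem (s := {i | i ∈ l}) hl.1 (hv j)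

theorem linearIndependent_of_relationsIn {ι N : Type*} [Fintype ι] [AddCommGroup N]
    [Module (MvPolynomial σ R) N] {l : List σ} (hl : l.Nodup) {n : ι → N}
    (hspan : Submodule.span (MvPolynomial σ R) (Set.range n) = ⊤)
    (hreg : IsWeaklyRegular N (l.map (X : σ → MvPolynomial σ R)))
    (hrel : RelationsIn (Ideal.span (X '' {i | i ∈ l} : Set (MvPolynomial σ R))) n) :
    LinearIndependent (MvPolynomial σ R) n := by
  induction l using List.reverseRecOn with
  | nil => simpa [← relationsIn_bot] using hrel
  | append_singleton l i ih =>
    rw [List.nodup_append_comm, List.singleton_append, List.nodup_cons] at hl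
    rw [List.map_append, isWeaklyRegular_append_iff, List.map_singleton,
      isWeaklyRegular_singleton_iff, ofList_map_X] at hreg
    rw [← ofList_map_X, List.map_append, Ideal.ofList_append, ofList_map_X, List.map_singleton,
      Ideal.ofList_singleton] at hrel
    exact ih hl.2 hreg.1
      (hrel.of_sup_span_singleton hspan hreg.2 fun _ => mem_of_forall_mem_sup_X_pow)

variable [IsDomain R]

theorem isWeaklyRegular_ker_of_range_eq_ker {ι κ N : Type*} [Finite ι] [Finite κ] [AddCommGroup N]
    [Module (MvPolynomial σ R) N] [Module.IsTorsionFree (MvPolynomial σ R) N]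
    {φ : (ι → MvPolynomial σ R) →ₗ[MvPolynomial σ R] (κ → MvPolynomial σ R)}
    {χ : (κ → MvPolynomial σ R) →ₗ[MvPolynomial σ R] N}
    (hexact : LinearMap.range φ = LinearMap.ker χ) {i j k : σ} (hijk : [i, j, k].Nodup) :
    IsWeaklyRegular (LinearMap.ker φ) ([i, j, k].map (X : σ → MvPolynomial σ R)) := by
  have hχ : IsWeaklyRegular (LinearMap.range χ) ([i].map (X : σ → MvPolynomial σ R)) :=
    (isWeaklyRegular_singleton_iff _ _).2 (smul_right_injective _ (X_ne_zero i))
  have hφ : IsWeaklyRegular (LinearMap.range φ) ([i, j].map (X : σ → MvPolynomial σ R)) := by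
    rw [hexact]
    exact isWeaklyRegular_ker_append_singleton (rs := [X i])
      (isWeaklyRegular_pi_map_X (hijk.sublist (List.sublist_append_left [i, j] [k]))) hχ
  exact isWeaklyRegular_ker_append_singleton (rs := [X i, X j]) (isWeaklyRegular_pi_map_X hijk) hφ

end Variables

/-! ### Dimension counts -/

section Dimension

variable {K : Type*} [Field K]

variable {V W : Type*} [AddCommGroup V] [Module K V] [AddCommGroup W] [Module K W]
  {g : V →ₗ[K] W} {U : Submodule K V}

variable (g U) in
theorem finrank_map_add_finrank_ker_inf [FiniteDimensional K U] :
    Module.finrank K (U.map g) + Module.finrank K (LinearMap.ker g ⊓ U : Submodule K V) =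
      Module.finrank K U := by
  rw [← LinearMap.finrank_range_add_finrank_ker (g.domRestrict U), LinearMap.range_domRestrict,
    LinearMap.ker_domRestrict, inf_comm, ← Submodule.map_comap_subtype,
    Submodule.finrank_map_subtype_eq]

theorem map_eq_range_inf_of_isProj {U' : Submodule K W} {P : V →ₗ[K] V} {Q : W →ₗ[K] W}
    (hP : LinearMap.IsProj U P) (hQ : LinearMap.IsProj U' Q) (hgPQ : ∀ v, Q (g v) = g (P v)) :
    U.map g = LinearMap.range g ⊓ U' := by
  refine le_antisymm (le_inf LinearMap.map_le_range ?_) ?_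
  · rintro _ ⟨v, hv, rfl⟩
    rw [← hP.map_id v hv, ← hgPQ]
    exact hQ.map_mem _
  · rintro _ ⟨⟨v, rfl⟩, hv⟩
    exact ⟨P v, hP.map_mem v, (hgPQ v).symm.trans (hQ.map_id _ hv)⟩

theorem finrank_range_inf_add_finrank_ker_inf {U' : Submodule K W} [FiniteDimensional K U]
    {P : V →ₗ[K] V} {Q : W →ₗ[K] W} (hP : LinearMap.IsProj U P) (hQ : LinearMap.IsProj U' Q)
    (hgPQ : ∀ v, Q (g v) = g (P v)) :
    Module.finrank K (LinearMap.range g ⊓ U' : Submodule K W) +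
      Module.finrank K (LinearMap.ker g ⊓ U : Submodule K V) = Module.finrank K U := by
  rw [← map_eq_range_inf_of_isProj hP hQ hgPQ, finrank_map_add_finrank_ker_inf]

theorem isProj_component {σ R : Type*} [CommSemiring R] (k : ℤ) :
    LinearMap.IsProj (forms σ R k) (component (R := R) (σ := σ) k) :=
  ⟨component_mem_forms k, fun _ => component_eq_self⟩

theorem isProj_gradedComponent {σ R ι : Type*} [CommSemiring R] (b : ι → ℤ) (k : ℤ) :
    LinearMap.IsProj (gradedPiece σ R b k) (gradedComponent (R := R) (σ := σ) b k) :=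
  ⟨gradedComponent_mem_gradedPiece b k, fun _ => gradedComponent_eq_self⟩

instance {σ R : Type*} [CommSemiring R] [Finite σ] (k : ℤ) : Module.Finite R (forms σ R k) := by
  obtain hk | ⟨k, rfl⟩ := (lt_or_ge k 0).imp_right Int.eq_ofNat_of_zero_le
  · rw [forms_eq_bot hk]
    infer_instance
  · exact Module.Finite.iff_fg.2 (forms_natCast (σ := σ) (R := R) k ▸ homogeneousSubmodule_fg σ R k)

theorem finrank_forms_natCast (σ : Type*) [Fintype σ] (k : ℕ) :
    Module.finrank K (forms σ K k) = (Fintype.card σ + k - 1).choose k := by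
  classical
  have hforms : forms σ K k =
      restrictSupport K ((Finset.univ : Finset σ).finsuppAntidiag k : Set (σ →₀ ℕ)) := by
    ext p
    rw [mem_forms, mem_restrictSupport_iff]
    refine forall₂_congr fun s _ => ?_
    simp [Finset.mem_finsuppAntidiag, Finsupp.degree_eq_sum, -Nat.cast_sum]
  rw [hforms, Module.finrank_eq_nat_card_basis (basisRestrictSupport K _), Nat.card_coe_set_eq,
    Set.ncard_coe_finset, Finset.card_finsuppAntidiag_nat_eq_choose, Finset.card_univ]

/-- The formula is still correct at `k = -1` and `k = -2`, where both sides vanish. -/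
theorem two_mul_finrank_forms_fin_three {k : ℤ} (hk : -2 ≤ k) :
    2 * (Module.finrank K (forms (Fin 3) K k) : ℤ) = (k + 1) * (k + 2) := by
  obtain rfl | rfl | ⟨k, rfl⟩ : k = -2 ∨ k = -1 ∨ ∃ l : ℕ, k = l := by
    obtain hk' | hk' := lt_or_ge k 0
    · lia
    · exact .inr (.inr (Int.eq_ofNat_of_zero_le hk'))
  · simp [forms_eq_bot]
  · simp [forms_eq_bot]
  · rw [finrank_forms_natCast, Fintype.card_fin, show 3 + k - 1 = k + 2 by lia,
      Nat.choose_symm_add]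
    have hchoose := Nat.add_one_mul_choose_eq (k + 1) 1
    rw [Nat.choose_one_right] at hchoose
    push_cast [← Nat.cast_inj (R := ℤ)] at hchoose
    linarith

/-- A graded piece of a free module is a product of spaces of forms. -/
noncomputable def gradedPieceEquiv {σ R ι : Type*} [CommSemiring R] (b : ι → ℤ) (k : ℤ) :
    gradedPiece σ R b k ≃ₗ[R] (∀ j, forms σ R (k - b j)) where
  toFun v j := ⟨v.1 j, mem_gradedPiece.1 v.2 j⟩
  invFun v := ⟨fun j => v j, mem_gradedPiece.2 fun j => (v j).2⟩
  map_add' _ _ := rfl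
  map_smul' _ _ := rfl

instance {σ R ι : Type*} [CommSemiring R] [Finite σ] [Finite ι] (b : ι → ℤ) (k : ℤ) :
    Module.Finite R (gradedPiece σ R b k) :=
  Module.Finite.equiv (gradedPieceEquiv b k).symm

theorem two_mul_finrank_gradedPiece_fin_three {ι : Type*} [Fintype ι] {b : ι → ℤ} {k : ℤ}
    (hk : ∀ j, b j ≤ k + 2) :
    2 * (Module.finrank K (gradedPiece (Fin 3) K b k) : ℤ) =
      Fintype.card ι * ((k + 1) * (k + 2)) - (2 * k + 3) * ∑ j, b j + ∑ j, b j ^ 2 := by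
  have hforms (j : ι) : 2 * (Module.finrank K (forms (Fin 3) K (k - b j)) : ℤ) =
      (k + 1) * (k + 2) - (2 * k + 3) * b j + b j ^ 2 := by
    rw [two_mul_finrank_forms_fin_three (by linarith [hk j])]
    ring
  rw [(gradedPieceEquiv b k).finrank_eq, Module.finrank_pi_fintype, Nat.cast_sum, Finset.mul_sum]
  simp only [hforms, Finset.sum_add_distrib, Finset.sum_sub_distrib, Finset.sum_const,
    ← Finset.mul_sum, Finset.card_univ, nsmul_eq_mul]

end Dimension

/-! ### Coprime forms -/

section Coprime

theorem add_single_mem_support_of_mem_support_pderiv {σ R : Type*} [CommSemiring R]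
    {p : MvPolynomial σ R} {i : σ} {s : σ →₀ ℕ} (hs : s ∈ (pderiv i p).support) :
    s + Finsupp.single i 1 ∈ p.support := by
  rw [mem_support_iff, coeff_pderiv] at hs
  exact mem_support_iff.2 (left_ne_zero_of_mul hs)

theorem totalDegree_pderiv_lt {σ R : Type*} [CommSemiring R] {p : MvPolynomial σ R} {i : σ}
    (hp : pderiv i p ≠ 0) : (pderiv i p).totalDegree < p.totalDegree := by
  obtain ⟨s, hs, hdegree⟩ := Finset.exists_mem_eq_sup _ (support_nonempty.2 hp) Finsupp.degree
  calc (pderiv i p).totalDegree = s.degree := hdegree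
    _ < (s + Finsupp.single i 1).degree := by simp
    _ ≤ p.totalDegree := le_totalDegree (add_single_mem_support_of_mem_support_pderiv hs)

theorem pderiv_mem_forms {σ R : Type*} [CommSemiring R] {p : MvPolynomial σ R} {k : ℤ}
    (hp : p ∈ forms σ R k) (i : σ) : pderiv i p ∈ forms σ R (k - 1) := by
  refine mem_forms.2 fun s hs => ?_
  rw [← mem_forms.1 hp _ (add_single_mem_support_of_mem_support_pderiv hs)]
  simp

theorem eq_C_of_forall_pderiv_eq_zero {σ R : Type*} [CommRing R] [IsDomain R] [CharZero R]
    {p : MvPolynomial σ R} (hp : ∀ i, pderiv i p = 0) : p = C (coeff 0 p) := by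
  classical
  ext s
  rw [coeff_C]
  split_ifs with hs
  · rw [← hs]
  · obtain ⟨i, hi⟩ := Finsupp.ne_iff.1 (Ne.symm hs)
    have h := congrArg (coeff (s - Finsupp.single i 1)) (hp i)
    rw [coeff_pderiv, coeff_zero, tsub_add_cancel_of_le
      (Finsupp.single_le_iff.2 (Nat.one_le_iff_ne_zero.2 hi))] at h
    exact (mul_eq_zero.1 h).resolve_right (Nat.cast_add_one_ne_zero _)

variable {σ K : Type*} [Field K]

theorem exists_not_dvd_pderiv_of_irreducible [CharZero K] {p : MvPolynomial σ K}
    (hp : Irreducible p) : ∃ i, ¬ p ∣ pderiv i p := by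
  by_contra! hdvd
  have hpC : p = C (coeff 0 p) := eq_C_of_forall_pderiv_eq_zero fun i => by
    by_contra hne
    exact (totalDegree_pderiv_lt hne).not_ge (totalDegree_le_of_dvd_of_isDomain (hdvd i) hne)
  have hcoeff : coeff 0 p ≠ 0 := fun h => hp.ne_zero (by rw [hpC, h, C_0])
  exact hp.not_isUnit (hpC ▸ (isUnit_iff_ne_zero.2 hcoeff).map C)

theorem exists_not_dvd_pderiv_of_squarefree [Finite σ] [CharZero K] {f p : MvPolynomial σ K}
    {d : ℕ} (hf : f.IsHomogeneous d) (hd : d ≠ 0) (hsq : Squarefree f) (hp : Irreducible p) :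
    ∃ i, ¬ p ∣ pderiv i f := by
  have := Fintype.ofFinite σ
  by_contra! hdvd
  have hpf : p ∣ f := by
    have hEuler : p ∣ C (d : K) * f := by
      rw [map_natCast, ← nsmul_eq_mul, ← hf.sum_X_mul_pderiv]
      exact Finset.dvd_sum fun i _ => (hdvd i).mul_left _
    exact ((isUnit_iff_ne_zero.2 (Nat.cast_ne_zero.2 hd)).map C).dvd_mul_left.1 hEuler
  obtain ⟨g, rfl⟩ := hpf
  have hpg : ¬ p ∣ g := fun h => hp.not_isUnit (hsq p (mul_dvd_mul_left p h))
  obtain ⟨i, hi⟩ := exists_not_dvd_pderiv_of_irreducible hp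
  have hdvd_i := hdvd i
  rw [pderiv_mul, dvd_add_left (dvd_mul_right _ _)] at hdvd_i
  exact (hp.prime.dvd_or_dvd hdvd_i).elim hi hpg

theorem exists_isRelPrime_mem {A : Type*} [CommRing A] [IsDomain A] [UniqueFactorizationMonoid A]
    [Infinite K] [Algebra K A] {V : Submodule K A} {a : A} (ha : a ≠ 0)
    (hV : ∀ p, Irreducible p → p ∣ a → ∃ v ∈ V, ¬ p ∣ v) : ∃ v ∈ V, IsRelPrime a v := by
  classical
  let multiples (p : A) : Submodule K V := ((Ideal.span {p}).restrictScalars K).comap V.subtype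
  have hmem (p : A) (v : V) : v ∈ multiples p ↔ p ∣ v := Ideal.mem_span_singleton
  have hcover := Subspace.biUnion_ne_univ_of_top_notMem
    (s := (UniqueFactorizationMonoid.factors a).toFinset.image multiples) (by
      simp only [Finset.mem_image, Multiset.mem_toFinset, not_exists, not_and]
      intro p hp htop
      obtain ⟨v, hv, hpv⟩ := hV p (UniqueFactorizationMonoid.irreducible_of_factor p hp)
        (UniqueFactorizationMonoid.dvd_of_mem_factors hp)
      exact hpv ((hmem p ⟨v, hv⟩).1 (htop ▸ trivial)))
  obtain ⟨v, hv⟩ := (Set.ne_univ_iff_exists_notMem _).1 hcover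
  simp only [Finset.mem_image, Multiset.mem_toFinset, Set.iUnion_exists, Set.biUnion_and',
    Set.iUnion_iUnion_eq_right, Set.mem_iUnion, SetLike.mem_coe, hmem, not_exists] at hv
  refine ⟨v, v.2, WfDvdMonoid.isRelPrime_of_no_irreducible_factors (fun h => ha h.1) ?_⟩
  intro p hp hpa hpv
  obtain ⟨q, hq, hpq⟩ := UniqueFactorizationMonoid.exists_mem_factors_of_dvd ha hp hpa
  exact hv q hq (hpq.symm.dvd.trans hpv)

theorem component_linearCombination {ι R : Type*} [Fintype ι] [CommSemiring R] {δ : ι → ℤ}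
    {ρ : ι → MvPolynomial σ R} (hρ : ∀ i, ρ i ∈ forms σ R (δ i)) (k : ℤ)
    (v : ι → MvPolynomial σ R) :
    component k (Fintype.linearCombination (MvPolynomial σ R) ρ v) =
      Fintype.linearCombination (MvPolynomial σ R) ρ (gradedComponent δ k v) := by
  simp only [Fintype.linearCombination_apply, map_sum, smul_eq_mul,
    component_mul_of_mem_forms (hρ _), gradedComponent_apply]

variable {a b : ℤ} {g h : MvPolynomial σ K}

theorem exists_mem_forms_of_mul_add_mul_eq_zero (hg : g ∈ forms σ K a) (hg0 : g ≠ 0)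
    (hgh : IsRelPrime g h) {k : ℤ} {u v : MvPolynomial σ K} (hv : v ∈ forms σ K (k - b))
    (huv : u * g + v * h = 0) : ∃ w ∈ forms σ K (k - a - b), u = w * -h ∧ v = w * g := by
  obtain ⟨w, rfl⟩ : g ∣ v := hgh.dvd_of_dvd_mul_right ⟨-u, by linear_combination huv⟩
  have hw : g * w = component (k - a - b) w * g := by
    rw [sub_right_comm, ← component_mul_of_mem_forms hg, mul_comm w, component_eq_self hv]
  refine ⟨component (k - a - b) w, component_mem_forms _ _, mul_right_cancel₀ hg0 ?_, hw⟩
  linear_combination huv - h * hw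

/-- The kernel of `(u, v) ↦ u * g + v * h` consists of the Koszul relations `w * (-h, g)`. -/
theorem finrank_gradedPiece_le_of_isRelPrime [Finite σ] {I : Ideal (MvPolynomial σ K)}
    (hg : g ∈ forms σ K a) (hh : h ∈ forms σ K b) (hgI : g ∈ I) (hhI : h ∈ I) (hg0 : g ≠ 0)
    (hgh : IsRelPrime g h) (k : ℤ) :
    Module.finrank K (gradedPiece σ K ![a, b] k) ≤
      Module.finrank K (I.restrictScalars K ⊓ forms σ K k : Submodule K (MvPolynomial σ K)) +
      Module.finrank K (forms σ K (k - a - b)) := by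
  let κ : (Fin 2 → MvPolynomial σ K) →ₗ[MvPolynomial σ K] MvPolynomial σ K :=
    Fintype.linearCombination _ ![g, h]
  let θ : MvPolynomial σ K →ₗ[MvPolynomial σ K] (Fin 2 → MvPolynomial σ K) :=
    LinearMap.toSpanSingleton _ _ ![-h, g]
  have hκ (v) : κ v = v 0 * g + v 1 * h := by
    simp [κ, Fintype.linearCombination_apply, Fin.sum_univ_two]
  have hfin : FiniteDimensional K
      (I.restrictScalars K ⊓ forms σ K k : Submodule K (MvPolynomial σ K)) :=
    Submodule.finiteDimensional_inf_right _ _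
  rw [← finrank_range_inf_add_finrank_ker_inf (g := κ.restrictScalars K)
    (isProj_gradedComponent ![a, b] k) (isProj_component k)
    (component_linearCombination (Fin.forall_fin_two.2 ⟨hg, hh⟩) k)]
  refine add_le_add (Submodule.finrank_mono (inf_le_inf_right _ ?_)) ?_
  · rintro _ ⟨v, rfl⟩
    exact (hκ v).symm ▸ I.add_mem (I.mul_mem_left _ hgI) (I.mul_mem_left _ hhI)
  · refine (Submodule.finrank_mono ?_).trans
      (Submodule.finrank_map_le (θ.restrictScalars K) (forms σ K (k - a - b)))
    rintro v ⟨hv, hvk⟩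
    obtain ⟨w, hw, h0, h1⟩ := exists_mem_forms_of_mul_add_mul_eq_zero hg hg0 hgh
      (mem_gradedPiece.1 hvk 1) ((hκ v).symm.trans hv)
    exact ⟨w, hw, funext (Fin.forall_fin_two.2 ⟨h0.symm, h1.symm⟩)⟩

end Coprime

/-! ### The Milnor algebra of a reduced curve -/

section MilnorAlgebra

variable {f : S} {d : ℕ}

theorem component_jacobianMap (hf : f.IsHomogeneous d) (k : ℤ) (v : Fin 3 → S) :
    component k (jacobianMap f v) =
      jacobianMap f (gradedComponent (fun _ => (d : ℤ) - 1) k v) :=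
  component_linearCombination (fun i => pderiv_mem_forms (mem_forms_natCast.2 hf) i) k v

theorem range_jacobianMap (f : S) : LinearMap.range (jacobianMap f) = jacobianIdeal f :=
  Fintype.range_linearCombination S _

theorem finrank_milnorComponent_add_finrank_inf_forms (f : S) (k : ℕ) :
    Module.finrank ℂ (milnorComponent f k) +
      Module.finrank ℂ ((jacobianIdeal f).restrictScalars ℂ ⊓ forms (Fin 3) ℂ k : Submodule ℂ S) =
      Module.finrank ℂ (forms (Fin 3) ℂ k) := by
  have hker : LinearMap.ker (Ideal.Quotient.mkₐ ℂ (jacobianIdeal f)).toLinearMap =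
      (jacobianIdeal f).restrictScalars ℂ :=
    Submodule.ext fun _ => Ideal.Quotient.eq_zero_iff_mem
  rw [milnorComponent, ← forms_natCast, ← hker, finrank_map_add_finrank_ker_inf]

theorem exists_isRelPrime_mem_jacobianIdeal (hf : f.IsHomogeneous d) (hd : d ≠ 0)
    (hsq : Squarefree f) :
    ∃ g ∈ jacobianIdeal f, g ∈ forms (Fin 3) ℂ (d - 1) ∧ g ≠ 0 ∧
      ∃ h ∈ jacobianIdeal f, h ∈ forms (Fin 3) ℂ (d - 1) ∧ IsRelPrime g h := by
  let V : Submodule ℂ S := (jacobianIdeal f).restrictScalars ℂ ⊓ forms (Fin 3) ℂ (d - 1)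
  have hpderiv (i : Fin 3) : pderiv i f ∈ V :=
    ⟨Ideal.subset_span ⟨i, rfl⟩, pderiv_mem_forms (mem_forms_natCast.2 hf) i⟩
  have hV (p : S) (hp : Irreducible p) : ∃ v ∈ V, ¬ p ∣ v :=
    (exists_not_dvd_pderiv_of_squarefree hf hd hsq hp).imp' (pderiv · f) fun i hi => ⟨hpderiv i, hi⟩
  obtain ⟨g, hg, hXg⟩ := hV (X 0) X_prime.irreducible
  have hg0 : g ≠ 0 := fun h => hXg (h ▸ dvd_zero _)
  obtain ⟨h, hh, hgh⟩ := exists_isRelPrime_mem hg0 fun p hp _ => hV p hp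
  exact ⟨g, hg.1, hg.2, hg0, h, hh.1, hh.2, hgh⟩

theorem finrank_milnorComponent_le (hf : f.IsHomogeneous d) (hd : d ≠ 0) (hsq : Squarefree f)
    {k : ℕ} (hk : 2 * d ≤ k) :
    (Module.finrank ℂ (milnorComponent f k) : ℤ) ≤ ((d : ℤ) - 1) ^ 2 := by
  obtain ⟨g, hgJ, hg, hg0, h, hhJ, hh, hgh⟩ := exists_isRelPrime_mem_jacobianIdeal hf hd hsq
  have hKoszul := finrank_gradedPiece_le_of_isRelPrime hg hh hgJ hhJ hg0 hgh k
  have hmilnor := finrank_milnorComponent_add_finrank_inf_forms f k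
  have hpair := two_mul_finrank_gradedPiece_fin_three (K := ℂ) (ι := Fin 2) (k := k)
    (b := ![(d : ℤ) - 1, (d : ℤ) - 1]) (Fin.forall_fin_two.2 (by simp; lia))
  have hforms := two_mul_finrank_forms_fin_three (K := ℂ) (k := k) (by lia)
  have hrel := two_mul_finrank_forms_fin_three (K := ℂ) (k := k - (d - 1) - (d - 1)) (by lia)
  simp only [Fin.sum_univ_two, Matrix.cons_val_zero, Matrix.cons_val_one, Fintype.card_fin,
    Nat.cast_ofNat] at hpair
  zify at hKoszul hmilnor
  linarith

end MilnorAlgebra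

/-! ### Graded free resolutions of the Milnor algebra -/

section GradedHom

theorem linearCombination_map_single {A ι N : Type*} [CommSemiring A] [Fintype ι] [DecidableEq ι]
    [AddCommMonoid N] [Module A N] (φ : (ι → A) →ₗ[A] N) :
    Fintype.linearCombination A (fun i => φ (Pi.single i 1)) = φ :=
  LinearMap.pi_ext' fun i => LinearMap.ext_ring (by simp)

variable {p q : ℕ} {b : Fin p → ℤ} {a : Fin q → ℤ}

theorem isGradedHom_iff {φ : (Fin p → S) →ₗ[S] (Fin q → S)} :
    IsGradedHom b a φ ↔ ∀ j, φ (Pi.single j 1) ∈ gradedPiece (Fin 3) ℂ a (b j) := by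
  simp only [IsGradedHom, IsHomogeneousZ, mem_gradedPiece, mem_forms]

theorem isGradedHom_linearCombination_iff {ρ : Fin p → Fin q → S} :
    IsGradedHom b a (Fintype.linearCombination S ρ) ↔
      ∀ j, ρ j ∈ gradedPiece (Fin 3) ℂ a (b j) := by
  simp only [isGradedHom_iff, Fintype.linearCombination_apply_single, one_smul]

theorem IsGradedHom.gradedComponent_map {φ : (Fin p → S) →ₗ[S] (Fin q → S)}
    (hφ : IsGradedHom b a φ) (k : ℤ) (v : Fin p → S) :
    gradedComponent a k (φ v) = φ (gradedComponent b k v) := by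
  rw [← linearCombination_map_single φ] at hφ ⊢
  simp only [Fintype.linearCombination_apply, gradedComponent_apply,
    gradedComponent_sum_smul (isGradedHom_linearCombination_iff.1 hφ)]

end GradedHom

theorem natDegree_eq_zero_of_eventually_abs_eval_natCast_le {𝕜 : Type*} [NormedField 𝕜]
    [LinearOrder 𝕜] [IsStrictOrderedRing 𝕜] [OrderTopology 𝕜] [Archimedean 𝕜]
    {P : Polynomial 𝕜} {D : 𝕜} (h : ∀ᶠ k : ℕ in Filter.atTop, |P.eval (k : 𝕜)| ≤ D) :
    P.natDegree = 0 := by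
  by_contra hP
  have htendsto := (P.abs_tendsto_atTop (Polynomial.natDegree_pos_iff_degree_pos.1
    (Nat.pos_of_ne_zero hP))).comp tendsto_natCast_atTop_atTop
  obtain ⟨k, hle, hlt⟩ := (h.and (htendsto.eventually_gt_atTop D)).exists
  exact hlt.not_ge hle

theorem eq_zero_of_eventually_abs_quadratic_le {A B C D : ℤ}
    (h : ∀ᶠ k : ℕ in Filter.atTop, |A * (k : ℤ) ^ 2 + B * k + C| ≤ D) : A = 0 ∧ B = 0 := by
  let P : Polynomial ℝ :=
    .C (A : ℝ) * .X ^ 2 + .C (B : ℝ) * .X + .C (C : ℝ)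
  have hP : P.natDegree = 0 := by
    refine natDegree_eq_zero_of_eventually_abs_eval_natCast_le (D := (D : ℝ)) ?_
    refine h.mono fun k hk => ?_
    simpa [P] using mod_cast hk
  constructor
  · have hcoeff : P.coeff 2 = 0 := Polynomial.coeff_eq_zero_of_natDegree_lt (by lia)
    simpa [P, Polynomial.coeff_X, Polynomial.coeff_C, -map_intCast, -eq_intCast] using hcoeff
  · have hcoeff : P.coeff 1 = 0 := Polynomial.coeff_eq_zero_of_natDegree_lt (by lia)
    simpa [P, Polynomial.coeff_X, Polynomial.coeff_C, -map_intCast, -eq_intCast] using hcoeff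

section Resolution

variable {f : S} {d p n : ℕ} {b : Fin p → ℤ} {e : Fin n → ℤ}
  {φ : (Fin p → S) →ₗ[S] (Fin 3 → S)} {ψ : (Fin n → S) →ₗ[S] (Fin p → S)}

/-- `φ` and `ψ` are the two middle maps of a graded free resolution
`0 → ⨁ᵢ S(-e i) → ⨁ⱼ S(-b j) → S(1-d)³ → S` of `M(f)`, not necessarily minimal, whose last map is
the Jacobian map. -/
structure IsGradedResolution (f : S) (d : ℕ) (b : Fin p → ℤ) (e : Fin n → ℤ)
    (φ : (Fin p → S) →ₗ[S] (Fin 3 → S)) (ψ : (Fin n → S) →ₗ[S] (Fin p → S)) : Prop where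
  isGradedHom : IsGradedHom b (fun _ => (d : ℤ) - 1) φ
  isGradedHom_syzygies : IsGradedHom e b ψ
  range_eq_ker_jacobianMap : LinearMap.range φ = LinearMap.ker (jacobianMap f)
  range_eq_ker : LinearMap.range ψ = LinearMap.ker φ
  injective : Function.Injective ψ

theorem IsGradedResolution.finrank_milnorComponent (hres : IsGradedResolution f d b e φ ψ)
    (hf : f.IsHomogeneous d) (k : ℕ) :
    (Module.finrank ℂ (milnorComponent f k) : ℤ) = Module.finrank ℂ (forms (Fin 3) ℂ k) -
      Module.finrank ℂ (gradedPiece (Fin 3) ℂ (fun _ : Fin 3 => (d : ℤ) - 1) k) +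
      Module.finrank ℂ (gradedPiece (Fin 3) ℂ b k) -
      Module.finrank ℂ (gradedPiece (Fin 3) ℂ e k) := by
  have hmilnor := finrank_milnorComponent_add_finrank_inf_forms f k
  have hjacobian := finrank_range_inf_add_finrank_ker_inf
    (g := (jacobianMap f).restrictScalars ℂ) (isProj_gradedComponent (fun _ => (d : ℤ) - 1) k)
    (isProj_component k) (component_jacobianMap hf k)
  have hφ := finrank_range_inf_add_finrank_ker_inf (g := φ.restrictScalars ℂ)
    (isProj_gradedComponent b k) (isProj_gradedComponent _ k)
    (hres.isGradedHom.gradedComponent_map k)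
  have hψ := finrank_range_inf_add_finrank_ker_inf (g := ψ.restrictScalars ℂ)
    (isProj_gradedComponent e k) (isProj_gradedComponent b k)
    (hres.isGradedHom_syzygies.gradedComponent_map k)
  rw [LinearMap.range_restrictScalars, LinearMap.ker_restrictScalars, range_jacobianMap,
    ← hres.range_eq_ker_jacobianMap] at hjacobian
  rw [LinearMap.range_restrictScalars, LinearMap.ker_restrictScalars, ← hres.range_eq_ker] at hφ
  rw [LinearMap.range_restrictScalars, LinearMap.ker_restrictScalars,
    LinearMap.ker_eq_bot.2 hres.injective, Submodule.restrictScalars_bot, bot_inf_eq,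
    finrank_bot] at hψ
  lia

theorem IsGradedResolution.eventually_two_mul_finrank_milnorComponent
    (hres : IsGradedResolution f d b e φ ψ) (hf : f.IsHomogeneous d) :
    ∀ᶠ k : ℕ in Filter.atTop, 2 * (Module.finrank ℂ (milnorComponent f k) : ℤ) =
      (p - n - 2) * ((k : ℤ) + 1) * (k + 2) -
      (2 * k + 3) * (∑ j, b j - ∑ i, e i - 3 * (d - 1)) +
      (∑ j, b j ^ 2 - ∑ i, e i ^ 2 - 3 * ((d : ℤ) - 1) ^ 2) := by
  have hlarge (l : ℤ) : ∀ᶠ k : ℕ in Filter.atTop, l ≤ (k : ℤ) + 2 :=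
    (tendsto_natCast_atTop_atTop.eventually_ge_atTop l).mono fun k hk => by lia
  filter_upwards [hlarge (d - 1), Filter.eventually_all.2 fun j => hlarge (b j),
    Filter.eventually_all.2 fun i => hlarge (e i)] with k hkd hkb hke
  have hdim := hres.finrank_milnorComponent hf k
  have hforms := two_mul_finrank_forms_fin_three (K := ℂ) (k := k) (by lia)
  have hdeg := two_mul_finrank_gradedPiece_fin_three (K := ℂ) fun _ : Fin 3 => hkd
  have hb := two_mul_finrank_gradedPiece_fin_three (K := ℂ) hkb
  have he := two_mul_finrank_gradedPiece_fin_three (K := ℂ) hke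
  simp only [Fin.sum_univ_three, Fintype.card_fin, Nat.cast_ofNat] at hdeg hb he
  linear_combination 2 * hdim + hforms - hdeg + hb - he

/-- The Hilbert function of `M(f)` is bounded, so the coefficients of `k ^ 2` and `k` in the Hilbert
polynomial read off from the resolution vanish. -/
theorem IsGradedResolution.card_add_two_eq_and_sum_degree
    (hres : IsGradedResolution f d b e φ ψ) (hf : f.IsHomogeneous d) (hd : d ≠ 0)
    (hsq : Squarefree f) : n + 2 = p ∧ ∑ i, e i = ∑ j, b j - 3 * ((d : ℤ) - 1) := by
  obtain ⟨hA, hB⟩ := eq_zero_of_eventually_abs_quadratic_le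
    (A := p - n - 2) (B := 3 * (p - n - 2) - 2 * (∑ j, b j - ∑ i, e i - 3 * (d - 1)))
    (C := 2 * (p - n - 2) - 3 * (∑ j, b j - ∑ i, e i - 3 * (d - 1)) +
      (∑ j, b j ^ 2 - ∑ i, e i ^ 2 - 3 * ((d : ℤ) - 1) ^ 2)) (D := 2 * ((d : ℤ) - 1) ^ 2) <| by
    filter_upwards [hres.eventually_two_mul_finrank_milnorComponent hf,
      Filter.eventually_ge_atTop (2 * d)] with k hk hkd
    have hle := finrank_milnorComponent_le hf hd hsq hkd
    rw [abs_le]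
    constructor <;> linarith
  exact ⟨by lia, by lia⟩

theorem IsGradedResolution.eventually_two_mul_finrank_milnorComponent_eq
    (hres : IsGradedResolution f d b e φ ψ) (hf : f.IsHomogeneous d) (hd : d ≠ 0)
    (hsq : Squarefree f) :
    ∀ᶠ k : ℕ in Filter.atTop, 2 * (Module.finrank ℂ (milnorComponent f k) : ℤ) =
      ∑ j, b j ^ 2 - ∑ i, e i ^ 2 - 3 * ((d : ℤ) - 1) ^ 2 := by
  obtain ⟨hcard, hsum⟩ := hres.card_add_two_eq_and_sum_degree hf hd hsq
  filter_upwards [hres.eventually_two_mul_finrank_milnorComponent hf] with k hk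
  have hcard' : (p : ℤ) - n - 2 = 0 := by lia
  rw [hk, hsum, hcard']
  ring

end Resolution

theorem linearIndependent_of_span_eq_ker {ι κ τ R N : Type*} [Finite ι] [Finite κ] [Fintype τ]
    [CommRing R] [IsDomain R] [AddCommGroup N] [Module (MvPolynomial (Fin 3) R) N]
    [Module.IsTorsionFree (MvPolynomial (Fin 3) R) N]
    {φ : (ι → MvPolynomial (Fin 3) R) →ₗ[MvPolynomial (Fin 3) R] (κ → MvPolynomial (Fin 3) R)}
    {χ : (κ → MvPolynomial (Fin 3) R) →ₗ[MvPolynomial (Fin 3) R] N}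
    (hexact : LinearMap.range φ = LinearMap.ker χ) {ν : τ → ι → MvPolynomial (Fin 3) R}
    (hspan : Submodule.span (MvPolynomial (Fin 3) R) (Set.range ν) = LinearMap.ker φ)
    (hrel : RelationsIn (idealOfVars (Fin 3) R) ν) :
    LinearIndependent (MvPolynomial (Fin 3) R) ν := by
  have hν (i : τ) : ν i ∈ LinearMap.ker φ := hspan ▸ Submodule.subset_span ⟨i, rfl⟩
  let n (i : τ) : LinearMap.ker φ := ⟨ν i, hν i⟩
  have hspan_n : Submodule.span (MvPolynomial (Fin 3) R) (Set.range n) = ⊤ :=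
    (Submodule.span_range_subtype_eq_top_iff _ hν).2 hspan
  have hrel_n : RelationsIn
      (Ideal.span (X '' {i | i ∈ [0, 1, 2]} : Set (MvPolynomial (Fin 3) R))) n := by
    have hvars : {i : Fin 3 | i ∈ [0, 1, 2]} = Set.univ := by
      ext i
      fin_cases i <;> simp
    rw [hvars, Set.image_univ]
    exact fun c hc => hrel c (by simpa [n] using congrArg (LinearMap.ker φ).subtype hc)
  have hdistinct : [(0 : Fin 3), 1, 2].Nodup := by decide
  have hn : LinearIndependent (MvPolynomial (Fin 3) R) n :=
    linearIndependent_of_relationsIn hdistinct hspan_n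
      (isWeaklyRegular_ker_of_range_eq_ker hexact hdistinct) hrel_n
  exact hn.map' (LinearMap.ker φ).subtype (Submodule.ker_subtype _)

theorem isMinimalHom_iff_relationsIn {p n : ℕ} {N : Type*} [AddCommGroup N] [Module S N]
    {φ : (Fin p → S) →ₗ[S] N} {ψ : (Fin n → S) →ₗ[S] (Fin p → S)}
    (hexact : LinearMap.range ψ = LinearMap.ker φ) :
    IsMinimalHom ψ ↔ RelationsIn (idealOfVars (Fin 3) ℂ) fun j => φ (Pi.single j 1) := by
  have hrel (c : Fin p → S) : ∑ j, c j • φ (Pi.single j 1) = 0 ↔ c ∈ LinearMap.range ψ := by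
    rw [← Fintype.linearCombination_apply, linearCombination_map_single, hexact, LinearMap.mem_ker]
  simp only [RelationsIn, hrel, LinearMap.mem_range, forall_exists_index, forall_apply_eq_imp_iff,
    mem_idealOfVars]
  refine ⟨fun hmin u j => ?_, fun h i j => h (Pi.single i 1) j⟩
  rw [← linearCombination_map_single ψ, Fintype.linearCombination_apply, Finset.sum_apply, map_sum]
  exact Finset.sum_eq_zero fun i _ => by
    rw [Pi.smul_apply, smul_eq_mul, map_mul, hmin i j, mul_zero]

section Resolution

variable {f : S} {d p n : ℕ} {b : Fin p → ℤ} {e : Fin n → ℤ}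
  {φ : (Fin p → S) →ₗ[S] (Fin 3 → S)} {ψ : (Fin n → S) →ₗ[S] (Fin p → S)}

theorem exists_isGradedResolution {ρ : Fin p → Fin 3 → S}
    (hρ : ∀ j, ρ j ∈ gradedPiece (Fin 3) ℂ (fun _ => (d : ℤ) - 1) (b j))
    (hspan : Submodule.span S (Set.range ρ) = jacobianSyzygies f) :
    ∃ (n : ℕ) (e : Fin n → ℤ) (ψ : (Fin n → S) →ₗ[S] (Fin p → S)),
      IsGradedResolution f d b e (Fintype.linearCombination S ρ) ψ := by
  have hφ : IsGradedHom b (fun _ => (d : ℤ) - 1) (Fintype.linearCombination S ρ) :=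
    isGradedHom_linearCombination_iff.2 hρ
  have hexact : LinearMap.range (Fintype.linearCombination S ρ) = LinearMap.ker (jacobianMap f) :=
    (Fintype.range_linearCombination S ρ).trans hspan
  obtain ⟨n, e, ν, hν, hνspan, hνrel⟩ := exists_minimal_homogeneous_generators (a := b)
    (N := LinearMap.ker (Fintype.linearCombination S ρ)) fun k v hv => by
      rw [LinearMap.mem_ker, ← hφ.gradedComponent_map, LinearMap.mem_ker.1 hv, map_zero]
  exact ⟨n, e, Fintype.linearCombination S ν, hφ, isGradedHom_linearCombination_iff.2 hν, hexact,
    (Fintype.range_linearCombination S ν).trans hνspan,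
    linearIndependent_iff_injective_fintypeLinearCombination.1
      (linearIndependent_of_span_eq_ker hexact hνspan hνrel)⟩

theorem exists_degree_lt_of_isMinimalHom {q : ℕ} {a : Fin q → ℤ}
    {ψ : (Fin p → S) →ₗ[S] (Fin q → S)} (hψ : IsGradedHom b a ψ) (hmin : IsMinimalHom ψ)
    (hinj : Function.Injective ψ) (j : Fin p) : ∃ i, a i < b j := by
  have hne : ψ (Pi.single j 1) ≠ 0 :=
    (map_ne_zero_iff ψ hinj).2 (Pi.single_eq_zero_iff.not.2 one_ne_zero)
  obtain ⟨i, hi⟩ := Function.ne_iff.1 hne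
  have hmem := mem_gradedPiece.1 (isGradedHom_iff.1 hψ j) i
  refine ⟨i, lt_of_not_ge fun hle => hi ?_⟩
  obtain hlt | heq := hle.lt_or_eq
  · rwa [forms_eq_bot (by lia)] at hmem
  · rw [heq, sub_self] at hmem
    rw [← component_eq_self hmem, component_zero, hmin j i, C_0, Pi.zero_apply]

theorem IsGradedResolution.eq_of_generators_in_one_degree {m : ℕ} {l : ℤ} {ρ : Fin m → Fin 3 → S}
    (hres : IsGradedResolution f d b e φ ψ) (hψ : IsMinimalHom ψ)
    (hρ : ∀ i, ρ i ∈ gradedPiece (Fin 3) ℂ (fun _ => (d : ℤ) - 1) l)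
    (hspan : Submodule.span S (Set.range ρ) = jacobianSyzygies f)
    (hrel : RelationsIn (idealOfVars (Fin 3) ℂ) ρ) : p = m ∧ ∀ j, b j = l := by
  have hspan' : Submodule.span S (Set.range ρ) =
      Submodule.span S (Set.range fun j => φ (Pi.single j 1)) := by
    rw [hspan, ← Fintype.range_linearCombination S (fun j => φ (Pi.single j 1)),
      linearCombination_map_single, hres.range_eq_ker_jacobianMap, jacobianSyzygies]
  obtain ⟨π, hπ⟩ := exists_equiv_degree_eq hρ (isGradedHom_iff.1 hres.isGradedHom) hrel
    ((isMinimalHom_iff_relationsIn hres.range_eq_ker).1 hψ) hspan'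
  exact ⟨by simpa using Fintype.card_congr π, fun j => (hπ j).symm⟩

end Resolution

/-! ### Curves of type `(d, r, m)` -/

section CurveOfType

variable {f : S} {d r m n : ℕ} {e : Fin n → ℤ}

namespace IsGradedResolution

variable {φ : (Fin m → S) →ₗ[S] (Fin 3 → S)} {ψ : (Fin n → S) →ₗ[S] (Fin m → S)}

theorem add_le_degree (hres : IsGradedResolution f d (fun _ : Fin m => (d : ℤ) - 1 + r) e φ ψ)
    (hψ : IsMinimalHom ψ) (i : Fin n) : (d : ℤ) + r ≤ e i := by
  obtain ⟨_, hlt⟩ := exists_degree_lt_of_isMinimalHom hres.isGradedHom_syzygies hψ hres.injective i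
  lia

variable (hres : IsGradedResolution f d (fun _ : Fin m => (d : ℤ) - 1 + r) e φ ψ)
  (hf : f.IsHomogeneous d) (hsq : Squarefree f)

include hres hf hsq

theorem defect_eq_sum (hd : d ≠ 0) : defect d r m = ∑ i, (e i - (d + r - 1) - 1) := by
  obtain ⟨hcard, hsum⟩ := hres.card_add_two_eq_and_sum_degree hf hd hsq
  simp only [Finset.sum_sub_distrib, hsum, Finset.sum_const, Finset.card_univ, Fintype.card_fin,
    nsmul_eq_mul, defect, mMax, ← hcard, Nat.cast_add, Nat.cast_ofNat]
  ring

theorem ne_zero_of_isMinimalHom (hd : 3 ≤ d) (hψ : IsMinimalHom ψ) : r ≠ 0 := by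
  obtain ⟨hcard, -⟩ := hres.card_add_two_eq_and_sum_degree hf (by lia) hsq
  have hdefect : 0 ≤ defect d r m := by
    rw [hres.defect_eq_sum hf hsq (by lia)]
    exact Finset.sum_nonneg fun i _ => by linarith [hres.add_le_degree hψ i]
  rw [defect, mMax] at hdefect
  lia

theorem degree_eq_of_three (hd : d ≠ 0) (hm : m = 3) (i : Fin n) : e i = 3 * r := by
  obtain ⟨hcard, -⟩ := hres.card_add_two_eq_and_sum_degree hf hd hsq
  obtain rfl : n = 1 := by lia
  have hdefect := hres.defect_eq_sum hf hsq hd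
  rw [Fin.sum_univ_one, defect, mMax] at hdefect
  rw [Subsingleton.elim i 0]
  lia

theorem hasTotalTjurinaNumber_of_three (hd : d ≠ 0) (hm : m = 3) :
    HasTotalTjurinaNumber f (3 * (r : ℤ) * ((d : ℤ) - 1 - r)) := by
  obtain ⟨hcard, -⟩ := hres.card_add_two_eq_and_sum_degree hf hd hsq
  obtain rfl : n = 1 := by lia
  filter_upwards [hres.eventually_two_mul_finrank_milnorComponent_eq hf hd hsq] with k hk
  rw [Fin.sum_univ_one, hres.degree_eq_of_three hf hsq hd hm, Finset.sum_const, Finset.card_univ,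
    Fintype.card_fin, hm, nsmul_eq_mul] at hk
  push_cast at hk
  linarith

end IsGradedResolution

theorem IsGradedHom.isMinimalHom {p q : ℕ} {b : Fin p → ℤ} {a : Fin q → ℤ}
    {φ : (Fin p → S) →ₗ[S] (Fin q → S)} (hφ : IsGradedHom b a φ) (hba : ∀ j i, b j ≠ a i) :
    IsMinimalHom φ := fun j i =>
  constantCoeff_eq_zero_of_mem_forms (mem_gradedPiece.1 (isGradedHom_iff.1 hφ j) i)
    (sub_ne_zero.2 (hba j i))

theorem hasMinimalResolution_iff {p : ℕ} {b : Fin p → ℤ} :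
    HasMinimalResolution f d b e ↔
      ∃ φ ψ, IsGradedResolution f d b e φ ψ ∧ IsMinimalHom φ ∧ IsMinimalHom ψ :=
  ⟨fun ⟨φ, ψ, hφ, hψ, hφmin, hψmin, hexact, hexact', hinj⟩ =>
    ⟨φ, ψ, ⟨hφ, hψ, hexact, hexact', hinj⟩, hφmin, hψmin⟩,
  fun ⟨φ, ψ, ⟨hφ, hψ, hexact, hexact', hinj⟩, hφmin, hψmin⟩ =>
    ⟨φ, ψ, hφ, hψ, hφmin, hψmin, hexact, hexact', hinj⟩⟩

namespace IsCurveOfType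

variable (hC : IsCurveOfType f d r m)

include hC

theorem ne_zero : d ≠ 0 := by
  have := hC.three_le
  lia

theorem exists_generators : ∃ ρ : Fin m → Fin 3 → S,
    (∀ j, ρ j ∈ gradedPiece (Fin 3) ℂ (fun _ => (d : ℤ) - 1) ((d : ℤ) - 1 + r)) ∧
    Submodule.span S (Set.range ρ) = jacobianSyzygies f ∧
    RelationsIn (idealOfVars (Fin 3) ℂ) ρ := by
  obtain ⟨-, ρ, hρ, hspan, hmin⟩ := hC.exponents
  have hρ' (j : Fin m) : ρ j ∈ gradedPiece (Fin 3) ℂ (fun _ => (d : ℤ) - 1) ((d : ℤ) - 1 + r) :=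
    mem_gradedPiece.2 fun i => by
      rw [add_sub_cancel_left, mem_forms_natCast]
      exact hρ j i
  exact ⟨ρ, hρ', hspan, relationsIn_idealOfVars_of_irredundant hρ' hmin⟩

theorem exists_hasMinimalResolution : ∃ (n : ℕ) (e : Fin n → ℤ),
    HasMinimalResolution f d (fun _ : Fin m => (d : ℤ) - 1 + r) e := by
  obtain ⟨ρ, hρ, hspan, hrel⟩ := hC.exists_generators
  obtain ⟨n, e, ψ, hres⟩ := exists_isGradedResolution hρ hspan
  have hψ : IsMinimalHom ψ := (isMinimalHom_iff_relationsIn hres.range_eq_ker).2 <| by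
    simpa only [Fintype.linearCombination_apply_single, one_smul] using hrel
  have hr : r ≠ 0 := hres.ne_zero_of_isMinimalHom hC.homogeneous hC.reduced hC.three_le hψ
  exact ⟨n, e, hasMinimalResolution_iff.2
    ⟨_, ψ, hres, hres.isGradedHom.isMinimalHom fun _ _ => by lia, hψ⟩⟩

theorem eq_of_hasMinimalResolution {k : ℕ} {b : Fin k → ℤ} (h : HasMinimalResolution f d b e) :
    k = m ∧ ∀ j, b j = (d : ℤ) - 1 + r := by
  obtain ⟨φ, ψ, hres, -, hψ⟩ := hasMinimalResolution_iff.1 h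
  obtain ⟨ρ, hρ, hspan, hrel⟩ := hC.exists_generators
  exact hres.eq_of_generators_in_one_degree hψ hρ hspan hrel

end IsCurveOfType

end CurveOfType

end PlaneCurve

theorem mainTheorem3 (f : PlaneCurve.S) (d r m : ℕ) (hC : PlaneCurve.IsCurveOfType f d r m) :
    -- a minimal resolution of the Milnor algebra exists
    (∃ (n : ℕ) (e : Fin n → ℤ),
      PlaneCurve.HasMinimalResolution f d (fun _ : Fin m => (d : ℤ) - 1 + r) e) ∧
    -- the degrees in any minimal resolution
    (∀ (k n : ℕ) (b : Fin k → ℤ) (e : Fin n → ℤ), PlaneCurve.HasMinimalResolution f d b e →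
      k = m ∧ n + 2 = m ∧ (∀ j, b j = (d : ℤ) - 1 + r) ∧
      (∃ ε : Fin n → ℤ, (∀ j, 1 ≤ ε j) ∧ (∀ j, e j = (d : ℤ) + r - 1 + ε j) ∧
        PlaneCurve.defect d r m = ∑ j, (ε j - 1)) ∧
      (m = 3 → ∀ j, e j = 3 * (r : ℤ))) ∧
    -- the total Tjurina number
    (m = 3 → PlaneCurve.HasTotalTjurinaNumber f (3 * (r : ℤ) * ((d : ℤ) - 1 - r))) := by
  obtain ⟨n, e, hmin⟩ := hC.exists_hasMinimalResolution
  refine ⟨⟨n, e, hmin⟩, fun k n b e hmin => ?_, fun hm => ?_⟩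
  · obtain ⟨rfl, hb⟩ := hC.eq_of_hasMinimalResolution hmin
    obtain rfl : b = fun _ => (d : ℤ) - 1 + r := funext hb
    obtain ⟨φ, ψ, hres, -, hψ⟩ := PlaneCurve.hasMinimalResolution_iff.1 hmin
    exact ⟨rfl, (hres.card_add_two_eq_and_sum_degree hC.homogeneous hC.ne_zero hC.reduced).1, hb,
      ⟨fun j => e j - (d + r - 1), fun j => by linarith [hres.add_le_degree hψ j],
        fun j => by ring, hres.defect_eq_sum hC.homogeneous hC.reduced hC.ne_zero⟩,
      hres.degree_eq_of_three hC.homogeneous hC.reduced hC.ne_zero⟩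
  · obtain ⟨φ, ψ, hres, -⟩ := PlaneCurve.hasMinimalResolution_iff.1 hmin
    exact hres.hasTotalTjurinaNumber_of_three hC.homogeneous hC.reduced hC.ne_zero hm
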